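/- Let $d\ge 2$ and $k\in\mathbb N$. The vertices of the complete $d$-ary tree of height $k$ are the sequences of length at most $k$ with entries in $\{1,\dots,d\}$; the root is the empty sequence, and $\wp(i_1,\dots,i_m)=(i_1,\dots,i_{m-1})$ is the parent of $(i_1,\dots,i_m)$. Let $I_k$ be the set of non-root vertices and $L_k=\{1,\dots,d\}^k$ the set of leaves. Let $(\lambda_{i})_{i\in I_k}$ be real numbers with $\lambda_i>1$, and for a vertex $i$ of length $m$ put \[\widetilde\lambda_i=\prod_{j=0}^{m-1}\lambda_{\wp^j(i)},\qquad \widetilde\lambda_{tot}^{-1}=\sum_{i\in L_k}\widetilde\lambda_i^{-1}.\] For $\lambda>1$ let $\ell(x)=\lambda x$ and let $\widehat\ell:\mathbb Z\to\mathbb Z$ be its discretization: $\widehat\ell(x)$ is the unique integer with $\widehat\ell(x)-\lambda x\in(-\tfrac12,\tfrac12]$. Write $\widehat\ell_i$ for the discretization of $x\mapsto\lambda_i x$, and let \[\mu=\sum_{i\in L_k}\ \sum_{n\in\mathbb Z}\delta_{\widehat\ell_{\wp^{k-1}(i)}\circ\cdots\circ\widehat\ell_{\wp(i)}\circ\widehat\ell_{i}(n)}\]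 be the image, counted with multiplicities, of the counting measure on $d^k$ copies of $\mathbb Z$ (one for each leaf). For measures $\mu,\nu$ on $\mathbb R$ that are finite on bounded sets let \[c\delta_y(\mu,\nu)=\mu((0,y])+\tfrac12\mu(\{0\})-\nu((0,y])-\tfrac12\nu(\{0\}),\] \[d_C(\mu,\nu)=\lim_{R\to+\infty}\Big(\frac1R\int_0^R c\delta_y(\mu,\nu)^2\,dy\Big)^{1/2}\] when this limit exists. For $i,i'\in L_k$ let $k_0(i,i')=\min\{m\in\{0,\dots,k\}:\wp^m(i)=\wp^m(i')\}$. Suppose that the family $(\widetilde\lambda_i^{-1})_{i\in I_k}$ is $\mathbb Q$-free, that is, that it becomes linearly independent over $\mathbb Q$ when the number $1$ is added to it. Then $d_C(\mu,\widetilde\lambda_{tot}^{-1}\mathrm{Leb})$ exists and \[d_C\big(\mu,\widetilde\lambda_{tot}^{-1}\mathrm{Leb}\big)^2=\frac1{12\,\widetilde\lambda_{tot}^{2}}+\frac1{12}\sum_{i,i'\in L_k}\ \sum_{m=k_0(i,i')}^{k-1}\frac{\widetilde\lambda_{\wp^m(i)}\,\widetilde\lambda_{\wp^m(i')}}{\widetilde\lambda_i\,\widetilde\lambda_{i'}}.\]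 -/

import Mathlib

open MeasureTheory Filter Topology Set

noncomputable section

namespace TreeDiscretization

/-- The discretization of the homothety `x ↦ c * x`: the integer closest to `c * x`, ties being
rounded upwards (`discretize_sub_mem` and `discretize_unique` characterize it). -/
def discretize (c : ℝ) (x : ℤ) : ℤ := round (c * (x : ℝ))

theorem discretize_sub_mem (c : ℝ) (x : ℤ) :
    (discretize c x : ℝ) - c * x ∈ Ioc (-(1 / 2) : ℝ) (1 / 2) := by
  unfold discretize
  rw [round_eq]
  have h1 := Int.floor_le (c * (x : ℝ) + 1 / 2)
  have h2 := Int.lt_floor_add_one (c * (x : ℝ) + 1 / 2)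
  constructor <;> linarith

theorem discretize_unique (c : ℝ) (x n : ℤ)
    (h : (n : ℝ) - c * x ∈ Ioc (-(1 / 2) : ℝ) (1 / 2)) : n = discretize c x := by
  unfold discretize
  rw [round_eq, eq_comm, Int.floor_eq_iff]
  constructor <;> linarith [h.1, h.2]

/-- The parent `(i₁, …, i_{m-1})` of a vertex `(i₁, …, i_m)` of the `d`-ary tree. Vertices are
finite sequences of labels in `Fin d`; the root is the empty sequence. -/
def parent {d : ℕ} (i : List (Fin d)) : List (Fin d) := i.dropLast

/-- The non-root vertices of the complete `d`-ary tree of height `k`: sequences of length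
`m` with `1 ≤ m ≤ k`. -/
def treeNodes (d k : ℕ) : Set (List (Fin d)) := {i | 1 ≤ i.length ∧ i.length ≤ k}

/-- The leaves of the complete `d`-ary tree of height `k`: sequences of length `k`. -/
abbrev Leaf (d k : ℕ) : Type := List.Vector (Fin d) k

/-- The product of the multipliers met on the way from the vertex `i` to the root:
`lam i * lam (parent i) * ⋯ * lam (parent^(length i - 1) i)` (it is `1` at the root). -/
def pathMult {d : ℕ} (lam : List (Fin d) → ℝ) (i : List (Fin d)) : ℝ :=
  ∏ m ∈ Finset.range i.length, lam (parent^[m] i)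

/-- The total multiplier, defined by `totMult⁻¹ = ∑ (pathMult i)⁻¹` over the leaves `i`. -/
def totMult {d : ℕ} (lam : List (Fin d) → ℝ) (k : ℕ) : ℝ :=
  (∑ i : Leaf d k, (pathMult lam i.toList)⁻¹)⁻¹

/-- The composition of the first `m` discretized maps along the path from `i` to the root; the
map decorating `i` is applied first, then the one decorating `parent i`, and so on. -/
def pathDiscretization {d : ℕ} (lam : List (Fin d) → ℝ) (i : List (Fin d)) : ℕ → ℤ → ℤ
  | 0, x => x
  | m + 1, x => discretize (lam (parent^[m] i)) (pathDiscretization lam i m x)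

/-- The push-forward, by the discretized maps of the tree of height `k`, of the uniform
(counting) measure on `d ^ k` copies of `ℤ`, one above each leaf: the sum, with multiplicities,
of the Dirac masses at the images of all integers along all the paths from a leaf to the root. -/
def imageMeasure {d : ℕ} (lam : List (Fin d) → ℝ) (k : ℕ) : Measure ℝ :=
  ∑ i : Leaf d k,
    Measure.sum fun n : ℤ => Measure.dirac ((pathDiscretization lam i.toList k n : ℤ) : ℝ)

/-- The generation at which the paths from the leaves `i` and `j` to the root merge:
`min {m ∈ {0, …, k} | parent^m i = parent^m j}`. -/
def mergeTime {d k : ℕ} (i j : Leaf d k) : ℕ :=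
  sInf {m : ℕ | m ≤ k ∧ parent^[m] i.toList = parent^[m] j.toList}

/-- A family of real numbers is `ℚ`-free if it becomes linearly independent over `ℚ`
when the number `1` is added to it. -/
def IsQFree {ι : Type*} (f : ι → ℝ) : Prop :=
  LinearIndependent ℚ fun o : Option ι => o.elim 1 f

/-- The cumulated difference of two measures on `ℝ` at `y`. -/
def cumDiff (μ ν : Measure ℝ) (y : ℝ) : ℝ :=
  μ.real (Ioc 0 y) + 1 / 2 * μ.real {0} - ν.real (Ioc 0 y) - 1 / 2 * ν.real {0}

/-- The Cramér distance at scale `R`. -/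
def cramerDistAt (μ ν : Measure ℝ) (R : ℝ) : ℝ :=
  Real.sqrt (1 / R * ∫ y in (0 : ℝ)..R, cumDiff μ ν y ^ 2)

/-- The Cramér distance of `μ` and `ν` is well defined and equal to `D`: the measures are finite
on bounded sets of `[0, ∞)`, the square of the cumulated difference is integrable on each
`[0, R]`, and the distances at scale `R` converge to `D` as `R → +∞`. -/
def HasCramerDist (μ ν : Measure ℝ) (D : ℝ) : Prop :=
  (∀ y : ℝ, μ (Icc 0 y) < ⊤ ∧ ν (Icc 0 y) < ⊤) ∧
  (∀ R : ℝ, 0 < R → IntervalIntegrable (fun y => cumDiff μ ν y ^ 2) volume 0 R) ∧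
  Tendsto (cramerDistAt μ ν) atTop (𝓝 D)

end TreeDiscretization

end

/-!
The image of a composition of discretizations can be counted exactly. For `c > 1`,
`discretize c n ≤ M` means `n ≤ ⌈(M + 1/2) / c⌉ - 1`; so, if the count of integers of `(0, M]`
reached from a vertex is shifted by `1/2`, its value at a child is its value at the parent divided
by the multiplier `lam v` of the child, plus a rounding error `e_v` in `[-1/2, 1/2)`
(`centredCount_concat`). Unfolding this recursion (`cumDiff_eq`), the cumulated difference at
`y ≥ 0` is `totMult⁻¹ * (1/2 - fract y)` plus a fixed linear combination of the errors at
`N = ⌊y⌋`, in which the leaf `i` contributes each of its ancestors `v` with the weight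
`pathMult v / pathMult i`. On each unit interval the first term has integral zero and mean square
`totMult⁻² / 12`, and the second one is constant, so the mean squares add up. It remains to see
that the errors have mean square `1/12` and that errors at distinct vertices are uncorrelated when
`N` runs over the natural numbers.

Modulo `1`, `e_v` is minus the coordinate `N / pathMult v` of a rotation of the torus, plus a
combination with real coefficients of the errors at the proper ancestors of `v`, plus a constant.
The rotation is equidistributed by Weyl's criterion, and a triangular change of variables of
this kind preserves Lebesgue measure; but it is not continuous, since real multiples of an error
are not functions on the circle. `hasMean_prod_mul_linearChar` deals with this by replacing the
coordinates by the errors one vertex at a time, descending from the root, with test functions that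
are products of continuous functions on the interval `[-1/2, 1/2]`, not necessarily periodic. This
class is stable under the change of variables as far as characters of the new error are concerned,
and `hasMean_mul_comp` recovers all continuous functions from the characters, by Stone–Weierstrass
and a cut-off near the ends of the interval.
-/

namespace TreeDiscretization

/-! ### Averages of sequences -/

/-- The average of the first `n` terms of a complex sequence (`0` for `n = 0`). -/
noncomputable def average (u : ℕ → ℂ) (n : ℕ) : ℂ := (n : ℂ)⁻¹ * ∑ N ∈ Finset.range n, u N

/-- The sequence `u` has mean value `l`: its averages converge to `l`. -/
def HasMean (u : ℕ → ℂ) (l : ℂ) : Prop := Tendsto (average u) atTop (𝓝 l)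

theorem HasMean.add {u v : ℕ → ℂ} {l l' : ℂ} (hu : HasMean u l) (hv : HasMean v l') :
    HasMean (fun N => u N + v N) (l + l') := by
  refine (Tendsto.add hu hv).congr fun n => ?_
  simp [average, Finset.sum_add_distrib, mul_add]

theorem HasMean.const_mul {u : ℕ → ℂ} {l : ℂ} (hu : HasMean u l) (c : ℂ) :
    HasMean (fun N => c * u N) (c * l) := by
  refine (Tendsto.const_mul c hu).congr fun n => ?_
  simp only [average, ← Finset.mul_sum]
  ring

theorem HasMean.congr {u v : ℕ → ℂ} {l l' : ℂ} (hu : HasMean u l) (h : ∀ N, u N = v N)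
    (hl : l = l') : HasMean v l' := by
  rw [← funext h, ← hl]
  exact hu

theorem hasMean_zero : HasMean (fun _ => 0) 0 := by
  have : average (fun _ => 0) = fun _ => 0 := by funext n; simp [average]
  simp [HasMean, this]

theorem HasMean.sum {κ : Type*} (s : Finset κ) {u : κ → ℕ → ℂ} {l : κ → ℂ}
    (h : ∀ j ∈ s, HasMean (u j) (l j)) :
    HasMean (fun N => ∑ j ∈ s, u j N) (∑ j ∈ s, l j) := by
  classical
  induction s using Finset.induction_on with
  | empty => simpa using hasMean_zero
  | insert a s ha ih =>
    simp only [Finset.sum_insert ha]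
    exact (h a (by simp)).add (ih fun j hj => h j (by simp [hj]))

theorem average_sub (u v : ℕ → ℂ) (n : ℕ) :
    average u n - average v n = average (fun N => u N - v N) n := by
  simp [average, Finset.sum_sub_distrib, mul_sub]

theorem norm_average_le {u : ℕ → ℂ} {v : ℕ → ℝ} (h : ∀ N, ‖u N‖ ≤ v N) (n : ℕ) :
    ‖average u n‖ ≤ (n : ℝ)⁻¹ * ∑ N ∈ Finset.range n, v N := by
  rw [average, norm_mul, norm_inv, Complex.norm_natCast]
  gcongr
  exact (norm_sum_le _ _).trans (Finset.sum_le_sum fun N _ => h N)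

theorem norm_average_le_const {u : ℕ → ℂ} {B : ℝ} (hB : 0 ≤ B) (h : ∀ N, ‖u N‖ ≤ B) (n : ℕ) :
    ‖average u n‖ ≤ B := by
  refine (norm_average_le h n).trans ?_
  rcases Nat.eq_zero_or_pos n with rfl | hn
  · simpa using hB
  · have : (n : ℝ) ≠ 0 := by positivity
    simp [this]

theorem hasMean_const (c : ℂ) : HasMean (fun _ => c) c := by
  refine tendsto_const_nhds.congr' ?_
  filter_upwards [eventually_gt_atTop 0] with n hn
  have : (n : ℂ) ≠ 0 := by exact_mod_cast hn.ne'
  simp [average, this]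

/-- A sequence that can be approximated, up to an arbitrarily small average error, by sequences
with mean values close to `l`, has mean value `l`. -/
theorem hasMean_of_forall_approx {u : ℕ → ℂ} {l : ℂ}
    (h : ∀ ε > 0, ∃ v l', HasMean v l' ∧ ‖l' - l‖ ≤ ε ∧
      ∀ᶠ n in atTop, ‖average (fun N => u N - v N) n‖ ≤ ε) : HasMean u l := by
  refine Metric.tendsto_atTop'.2 fun ε hε => ?_
  obtain ⟨v, l', hv, hl, hev⟩ := h (ε / 4) (by positivity)
  have h2 := (Metric.tendsto_nhds.1 hv) (ε / 4) (by positivity)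
  obtain ⟨n₀, hn₀⟩ := eventually_atTop.1 (hev.and h2)
  refine ⟨n₀, fun n hn => ?_⟩
  obtain ⟨h3, h4⟩ := hn₀ n hn.le
  rw [dist_eq_norm] at h4 ⊢
  have h5 : average u n - l = average (fun N => u N - v N) n + (average v n - l') + (l' - l) := by
    rw [← average_sub]; ring
  rw [h5]
  have := norm_add₃_le (a := average (fun N => u N - v N) n) (b := average v n - l') (c := l' - l)
  linarith

/-- The geometric sequence of ratio `z` with `‖z‖ = 1`, `z ≠ 1` has mean value `0`. -/
theorem hasMean_geom {z : ℂ} (hz : ‖z‖ = 1) (hz1 : z ≠ 1) : HasMean (fun N => z ^ N) 0 := by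
  have hz2 : z - 1 ≠ 0 := sub_ne_zero.2 hz1
  have hlim : Tendsto (fun n : ℕ => (n : ℝ)⁻¹ * (2 / ‖z - 1‖)) atTop (𝓝 0) := by
    simpa using (tendsto_inv_atTop_nhds_zero_nat (𝕜 := ℝ)).mul_const (2 / ‖z - 1‖)
  refine squeeze_zero_norm (fun n => ?_) hlim
  rw [average, geom_sum_eq hz1, norm_mul, norm_inv, Complex.norm_natCast, norm_div]
  gcongr
  calc ‖z ^ n - 1‖ ≤ ‖z ^ n‖ + ‖(1 : ℂ)‖ := norm_sub_le _ _
    _ = 2 := by rw [norm_pow, hz]; norm_num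

/-! ### From characters to continuous functions on the closed unit interval -/

theorem intervalIntegral_fourier (m : ℤ) :
    ∫ t in (-(1 / 2) : ℝ)..(1 / 2), fourier m (t : AddCircle (1 : ℝ)) = if m = 0 then 1 else 0 := by
  split_ifs with hm
  · subst hm
    norm_num
  · simp only [fourier_coe_apply, Complex.ofReal_one, div_one]
    have hc : 2 * (Real.pi : ℂ) * Complex.I * m ≠ 0 := by
      simp [Real.pi_ne_zero, hm]
    rw [integral_exp_mul_complex hc]
    have : Complex.exp (2 * (Real.pi : ℂ) * Complex.I * m * ((1 / 2 : ℝ) : ℂ)) =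
        Complex.exp (2 * (Real.pi : ℂ) * Complex.I * m * ((-(1 / 2) : ℝ) : ℂ)) := by
      rw [Complex.exp_eq_exp_iff_exists_int]
      refine ⟨m, ?_⟩
      push_cast
      ring
    rw [this, sub_self, zero_div]

theorem continuous_comp_coe_addCircle (f : C(AddCircle (1 : ℝ), ℂ)) :
    Continuous fun t : ℝ => f (t : AddCircle (1 : ℝ)) :=
  f.continuous.comp (AddCircle.continuous_mk' 1)

/-- If the mean values of `ψ`, twisted by the characters of the circle along `u`, are those of an
independent uniform variable, the same is true for all continuous functions on the circle. -/
theorem hasMean_mul_circle {ψ : ℕ → ℂ} {B : ℝ} (hψ : ∀ N, ‖ψ N‖ ≤ B) {u : ℕ → ℝ} {l : ℂ}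
    (h : ∀ m : ℤ, HasMean (fun N => ψ N * fourier m (u N : AddCircle (1 : ℝ)))
      (if m = 0 then l else 0)) (f : C(AddCircle (1 : ℝ), ℂ)) :
    HasMean (fun N => ψ N * f (u N : AddCircle (1 : ℝ)))
      (l * ∫ t in (-(1 / 2) : ℝ)..(1 / 2), f (t : AddCircle (1 : ℝ))) := by
  have hB : 0 ≤ B := (norm_nonneg _).trans (hψ 0)
  have hspan : ∀ p ∈ Submodule.span ℂ (range (fourier (T := (1 : ℝ)))),
      HasMean (fun N => ψ N * p (u N : AddCircle (1 : ℝ)))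
        (l * ∫ t in (-(1 / 2) : ℝ)..(1 / 2), p (t : AddCircle (1 : ℝ))) := by
    intro p hp
    induction hp using Submodule.span_induction with
    | mem p hp =>
      obtain ⟨m, rfl⟩ := hp
      rw [intervalIntegral_fourier]
      simpa using h m
    | zero => simpa using hasMean_zero
    | add p q _ _ hp hq =>
      refine (hp.add hq).congr (fun N => by simp [mul_add]) ?_
      rw [← mul_add, ← intervalIntegral.integral_add
        ((continuous_comp_coe_addCircle p).intervalIntegrable _ _)
        ((continuous_comp_coe_addCircle q).intervalIntegrable _ _)]
      rfl
    | smul c p _ hp =>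
      refine (hp.const_mul c).congr (fun N => by simp; ring) ?_
      simp only [ContinuousMap.coe_smul, Pi.smul_apply, smul_eq_mul,
        intervalIntegral.integral_const_mul]
      ring
  refine hasMean_of_forall_approx fun ε hε => ?_
  have hf : f ∈ closure (Submodule.span ℂ (range (fourier (T := (1 : ℝ)))) : Set _) := by
    have := span_fourier_closure_eq_top (T := (1 : ℝ))
    rw [← Submodule.topologicalClosure_coe, this]
    trivial
  obtain ⟨p, hp, hfp⟩ := Metric.mem_closure_iff.1 hf (ε / (B + ‖l‖ + 1)) (by positivity)
  have hη : ∀ x, ‖f x - p x‖ ≤ ε / (B + ‖l‖ + 1) := fun x => by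
    rw [← dist_eq_norm]
    exact (ContinuousMap.dist_apply_le_dist x).trans hfp.le
  have hεB : B * (ε / (B + ‖l‖ + 1)) ≤ ε := by
    rw [mul_div_assoc', div_le_iff₀ (by positivity)]
    nlinarith [norm_nonneg l]
  have hεl : ‖l‖ * (ε / (B + ‖l‖ + 1)) ≤ ε := by
    rw [mul_div_assoc', div_le_iff₀ (by positivity)]
    nlinarith [norm_nonneg l]
  refine ⟨_, _, hspan p hp, ?_, Eventually.of_forall fun n => ?_⟩
  · rw [← mul_sub, norm_mul, ← intervalIntegral.integral_sub
      ((continuous_comp_coe_addCircle p).intervalIntegrable _ _)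
      ((continuous_comp_coe_addCircle f).intervalIntegrable _ _)]
    refine le_trans ?_ hεl
    gcongr
    refine (intervalIntegral.norm_integral_le_of_norm_le_const
      (C := ε / (B + ‖l‖ + 1)) fun t _ => ?_).trans ?_
    · rw [norm_sub_rev]; exact hη _
    · norm_num
  · refine (norm_average_le_const (by positivity) (fun N => ?_) n).trans hεB
    rw [← mul_sub, norm_mul]
    exact mul_le_mul (hψ N) (hη _) (norm_nonneg _) hB

/-- The same for a function that takes different values at the two ends of the interval
`[-1/2, 1/2]`: it is multiplied by the cut-off `1 - (2 t) ^ (2 n)`, which makes it periodic, and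
the error is dominated by the periodic function `(2 t) ^ (2 n)`, whose integral is small. -/
theorem hasMean_mul_comp {ψ : ℕ → ℂ} {B : ℝ} (hψ : ∀ N, ‖ψ N‖ ≤ B) {u : ℕ → ℝ}
    (hu : ∀ N, u N ∈ Ico (-(1 / 2) : ℝ) (1 / 2)) {l : ℂ}
    (h1 : ∀ m : ℤ, HasMean (fun N => fourier m (u N : AddCircle (1 : ℝ)))
      (if m = 0 then 1 else 0))
    (h : ∀ m : ℤ, HasMean (fun N => ψ N * fourier m (u N : AddCircle (1 : ℝ)))
      (if m = 0 then l else 0)) {φ : ℝ → ℂ} (hφ : Continuous φ) :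
    HasMean (fun N => ψ N * φ (u N)) (l * ∫ t in (-(1 / 2) : ℝ)..(1 / 2), φ t) := by
  have hB : 0 ≤ B := (norm_nonneg _).trans (hψ 0)
  -- A periodic continuous function on the line may be used as a function on the circle.
  have hper : ∀ {ψ' : ℕ → ℂ} {B' : ℝ} {l' : ℂ}, (∀ N, ‖ψ' N‖ ≤ B') →
      (∀ m : ℤ, HasMean (fun N => ψ' N * fourier m (u N : AddCircle (1 : ℝ)))
      (if m = 0 then l' else 0)) → ∀ g : ℝ → ℂ, Continuous g → g (-(1 / 2)) = g (1 / 2) →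
      HasMean (fun N => ψ' N * g (u N)) (l' * ∫ t in (-(1 / 2) : ℝ)..(1 / 2), g t) := by
    intro ψ' B' l' hψ' h' g hg hgg
    have hone : (-(1 / 2) : ℝ) + 1 = 1 / 2 := by norm_num
    have hcont : Continuous (AddCircle.liftIco (1 : ℝ) (-(1 / 2)) g) :=
      AddCircle.liftIco_continuous (by rw [hone]; exact hgg) hg.continuousOn
    have hval : ∀ t ∈ Ico (-(1 / 2) : ℝ) (1 / 2),
        AddCircle.liftIco (1 : ℝ) (-(1 / 2)) g (t : AddCircle (1 : ℝ)) = g t := fun t ht =>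
      AddCircle.liftIco_coe_apply (by rw [hone]; exact ht)
    refine (hasMean_mul_circle hψ' h' ⟨_, hcont⟩).congr (fun N => ?_) ?_
    · simp only [ContinuousMap.coe_mk, hval _ (hu N)]
    · congr 1
      refine intervalIntegral.integral_congr_Ioo_of_le (by norm_num) fun t ht => ?_
      simp only [ContinuousMap.coe_mk, hval t ⟨ht.1.le, ht.2⟩]
  obtain ⟨C, hC⟩ : ∃ C, ∀ t ∈ Icc (-(1 / 2) : ℝ) (1 / 2), ‖φ t‖ ≤ C :=
    isCompact_Icc.exists_bound_of_continuousOn hφ.continuousOn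
  have hC0 : 0 ≤ C := (norm_nonneg _).trans (hC 0 (by norm_num))
  refine hasMean_of_forall_approx fun ε hε => ?_
  set K := (B + ‖l‖ + 1) * (C + 1) with hK
  have hKpos : 0 < K := by positivity
  obtain ⟨n, hn⟩ := exists_nat_gt (K / ε)
  have hq : ∀ t : ℝ, 0 ≤ (2 * t) ^ (2 * n) := fun t => by rw [pow_mul]; positivity
  have hqc : Continuous fun t : ℝ => (2 * t) ^ (2 * n) := by fun_prop
  have hqint : ∫ t in (-(1 / 2) : ℝ)..(1 / 2), (2 * t) ^ (2 * n) = (1 : ℝ) / (2 * n + 1) := by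
    rw [intervalIntegral.integral_comp_mul_left (fun t => t ^ (2 * n)) (by norm_num), integral_pow]
    have : (2 * (-(1 / 2)) : ℝ) ^ (2 * n + 1) = -1 := by
      rw [show (2 * (-(1 / 2)) : ℝ) = -1 by norm_num, Odd.neg_one_pow ⟨n, rfl⟩]
    rw [this]
    push_cast
    norm_num
    ring
  have hsmall : K * ((1 : ℝ) / (2 * n + 1)) < ε := by
    rw [div_lt_iff₀ hε] at hn
    rw [mul_one_div, div_lt_iff₀ (by positivity)]
    have : 0 ≤ (n : ℝ) * ε := by positivity
    linarith
  have hBC : B * C ≤ K := by rw [hK]; nlinarith [norm_nonneg l, mul_nonneg hB hC0]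
  have hlC : ‖l‖ * C ≤ K := by
    rw [hK]; nlinarith [norm_nonneg l, mul_nonneg (norm_nonneg l) hC0, mul_nonneg hB hC0]
  have hends : ∀ t : ℝ, t = -(1 / 2) ∨ t = 1 / 2 → (2 * t) ^ (2 * n) = 1 := by
    rintro t (rfl | rfl)
    · rw [show (2 * (-(1 / 2)) : ℝ) = -1 by norm_num, Even.neg_one_pow ⟨n, by ring⟩]
    · norm_num
  refine ⟨fun N => ψ N * (φ (u N) * ((1 - (2 * u N) ^ (2 * n) : ℝ) : ℂ)), _,
    hper hψ h (fun t => φ t * ((1 - (2 * t) ^ (2 * n) : ℝ) : ℂ)) (by fun_prop)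
      (by rw [hends _ (Or.inl rfl), hends _ (Or.inr rfl)]; simp), ?_, ?_⟩
  · rw [← mul_sub, norm_mul, ← intervalIntegral.integral_sub
      ((by fun_prop : Continuous _).intervalIntegrable _ _) (hφ.intervalIntegrable _ _)]
    refine le_trans ?_ hsmall.le
    have : ‖∫ t in (-(1 / 2) : ℝ)..(1 / 2), (φ t * ((1 - (2 * t) ^ (2 * n) : ℝ) : ℂ) - φ t)‖ ≤
        ∫ t in (-(1 / 2) : ℝ)..(1 / 2), C * (2 * t) ^ (2 * n) := by
      refine intervalIntegral.norm_integral_le_of_norm_le (by norm_num)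
        (Eventually.of_forall fun t ht => ?_)
        ((by fun_prop : Continuous _).intervalIntegrable _ _)
      have : φ t * ((1 - (2 * t) ^ (2 * n) : ℝ) : ℂ) - φ t =
          -(φ t * (((2 * t) ^ (2 * n) : ℝ) : ℂ)) := by push_cast; ring
      rw [this, norm_neg, norm_mul, Complex.norm_real, Real.norm_of_nonneg (hq t)]
      exact mul_le_mul_of_nonneg_right (hC t ⟨ht.1.le, ht.2⟩) (hq t)
    rw [intervalIntegral.integral_const_mul, hqint] at this
    calc _ ≤ ‖l‖ * (C * (1 / (2 * n + 1))) := by gcongr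
      _ = ‖l‖ * C * (1 / (2 * n + 1)) := by ring
      _ ≤ _ := by gcongr
  · have hq1 := hper (ψ' := fun _ => 1) (B' := 1) (l' := 1) (by simp) (by simpa using h1)
      (fun t => (((2 * t) ^ (2 * n) : ℝ) : ℂ)) (by fun_prop)
      (by rw [hends _ (Or.inl rfl), hends _ (Or.inr rfl)])
    simp only [one_mul] at hq1
    rw [intervalIntegral.integral_ofReal, hqint] at hq1
    have hq2 := (hq1.const_mul (B * C : ℝ)).norm
    have hlt : ‖((B * C : ℝ) : ℂ) * ((1 / (2 * n + 1) : ℝ) : ℂ)‖ < ε := by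
      rw [← Complex.ofReal_mul, Complex.norm_real, Real.norm_of_nonneg (by positivity)]
      refine lt_of_le_of_lt ?_ hsmall
      gcongr
    filter_upwards [hq2.eventually_lt_const hlt] with m hm
    refine le_trans ?_ hm.le
    refine (norm_average_le (v := fun N => B * C * (2 * u N) ^ (2 * n)) (fun N => ?_) m).trans ?_
    · have : ψ N * φ (u N) - ψ N * (φ (u N) * ((1 - (2 * u N) ^ (2 * n) : ℝ) : ℂ)) =
          ψ N * φ (u N) * (((2 * u N) ^ (2 * n) : ℝ) : ℂ) := by push_cast; ring
      rw [this, norm_mul, norm_mul, Complex.norm_real, Real.norm_of_nonneg (hq _)]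
      have := mul_le_mul (hψ N) (hC _ ⟨(hu N).1, (hu N).2.le⟩) (norm_nonneg _) hB
      exact mul_le_mul_of_nonneg_right this (hq _)
    · refine le_trans (le_abs_self _) (le_of_eq ?_)
      rw [← Real.norm_eq_abs, ← Complex.norm_real]
      simp [average]

/-! ### Equidistribution of triangular systems of rounding errors -/

/-- The centred rounding error `⌈x⌉ - x - 1/2`, with values in `[-1/2, 1/2)`. -/
noncomputable def roundingError (x : ℝ) : ℝ := ⌈x⌉ - x - 1 / 2

theorem roundingError_mem (x : ℝ) : roundingError x ∈ Ico (-(1 / 2) : ℝ) (1 / 2) := by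
  unfold roundingError
  constructor <;> linarith [Int.le_ceil x, Int.ceil_lt_add_one x]

/-- Modulo `1`, the rounding error of `x` is `-x - 1/2`. -/
theorem fourier_roundingError (m : ℤ) (x : ℝ) :
    fourier m (roundingError x : AddCircle (1 : ℝ)) =
      Complex.exp (-(2 * Real.pi * Complex.I * m * (x + 1 / 2))) := by
  rw [fourier_coe_apply, Complex.exp_eq_exp_iff_exists_int]
  refine ⟨m * ⌈x⌉, ?_⟩
  simp only [roundingError]
  push_cast
  ring

variable {ι : Type*} [Fintype ι]

/-- The character with integer frequencies `k`, at the point `N • α` of the torus. -/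
noncomputable def linearChar (α : ι → ℝ) (k : ι → ℤ) (N : ℕ) : ℂ :=
  Complex.exp (2 * Real.pi * Complex.I * (∑ v, k v * α v : ℝ) * N)

theorem norm_linearChar (α : ι → ℝ) (k : ι → ℤ) (N : ℕ) : ‖linearChar α k N‖ = 1 := by
  have : 2 * Real.pi * Complex.I * (∑ v, k v * α v : ℝ) * N =
      ((2 * Real.pi * (∑ v, k v * α v) * N : ℝ) : ℂ) * Complex.I := by
    push_cast
    ring
  rw [linearChar, this, Complex.norm_exp_ofReal_mul_I]

theorem IsQFree.eq_zero_of_sum_eq_int {α : ι → ℝ} (h : IsQFree α) {k : ι → ℤ} {n : ℤ}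
    (hk : ∑ v, k v * α v = n) : k = 0 := by
  have h' := Fintype.linearIndependent_iff.1 h
    (fun o => o.elim (-n : ℚ) fun v => (k v : ℚ)) (by
      simp [Fintype.sum_option, Rat.smul_def, hk])
  funext v
  simpa using h' (some v)

/-- Weyl's criterion: a nontrivial character has mean value `0` along the multiples of a point
whose coordinates are rationally independent, together with `1`. -/
theorem hasMean_linearChar {α : ι → ℝ} (h : IsQFree α) (k : ι → ℤ) [Decidable (k = 0)] :
    HasMean (linearChar α k) (if k = 0 then 1 else 0) := by
  have hpow : linearChar α k =
      fun N => Complex.exp (2 * Real.pi * Complex.I * (∑ v, k v * α v : ℝ)) ^ N := by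
    funext N
    rw [linearChar, ← Complex.exp_nat_mul]
    congr 1
    ring
  split_ifs with hk
  · subst hk
    simpa [hpow] using hasMean_const 1
  · rw [hpow]
    refine hasMean_geom ?_ fun h1 => hk ?_
    · simpa [linearChar] using norm_linearChar α k 1
    · obtain ⟨n, hn⟩ := Complex.exp_eq_one_iff.1 h1
      refine h.eq_zero_of_sum_eq_int (n := n) ?_
      have h2 : (2 * Real.pi * Complex.I) * ((∑ v, k v * α v : ℝ) : ℂ) =
          (2 * Real.pi * Complex.I) * n := by rw [hn]; ring
      exact_mod_cast mul_left_cancel₀ Complex.two_pi_I_ne_zero h2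

/-- A triangular system of rounding errors driven by a rationally independent rotation is
equidistributed. The coordinates of the rotation are replaced one by one by the errors, in the
order given by `rank`. The test functions `φ v` are continuous on the interval, not periodic:
this is what absorbs the real coefficients `A v w`, because the factor
`exp (-2πi m ∑ A v w e_w)` in a character of the error `e v` is a product of such functions of the
earlier errors. -/
theorem hasMean_prod_mul_linearChar [DecidableEq ι] {α β : ι → ℝ} (hα : IsQFree α) (rank : ι → ℕ)
    {A : ι → ι → ℝ} (hA : ∀ v w, A v w ≠ 0 → rank w < rank v) {e : ι → ℕ → ℝ}
    (he : ∀ v N, e v N = roundingError (α v * N + β v + ∑ w, A v w * e w N)) (s : Finset ι) :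
    (∀ v ∈ s, ∀ w, A v w ≠ 0 → w ∈ s) → ∀ (φ : ι → ℝ → ℂ) (k : ι → ℤ),
      (∀ v, Continuous (φ v)) → (∀ v ∈ s, k v = 0) →
      HasMean (fun N => (∏ v ∈ s, φ v (e v N)) * linearChar α k N)
        (if k = 0 then ∏ v ∈ s, ∫ t in (-(1 / 2) : ℝ)..(1 / 2), φ v t else 0) := by
  have hmem : ∀ v N, e v N ∈ Ico (-(1 / 2) : ℝ) (1 / 2) := fun v N => by
    rw [he]
    exact roundingError_mem _
  induction s using Finset.induction_on_max_value rank with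
  | empty =>
    intro _ φ k _ _
    simpa using hasMean_linearChar hα k
  | insert a s ha hmax ih =>
    intro hcl φ k hφ hk
    have hcl' : ∀ v ∈ s, ∀ w, A v w ≠ 0 → w ∈ s := by
      intro v hv w hw
      refine (Finset.mem_insert.1 (hcl v (Finset.mem_insert_of_mem hv) w hw)).resolve_left ?_
      rintro rfl
      exact absurd (hA v w hw) (not_lt.2 (hmax v hv))
    have has : ∀ w, A a w ≠ 0 → w ∈ s := by
      intro w hw
      refine (Finset.mem_insert.1 (hcl a (Finset.mem_insert_self _ _) w hw)).resolve_left ?_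
      rintro rfl
      exact absurd (hA w w hw) (lt_irrefl _)
    have key : ∀ (φ : ι → ℝ → ℂ) (k : ι → ℤ), (∀ v, Continuous (φ v)) →
        (∀ v ∈ insert a s, k v = 0) → ∀ m : ℤ,
        HasMean (fun N => (∏ v ∈ s, φ v (e v N)) * linearChar α k N *
            fourier m (e a N : AddCircle (1 : ℝ)))
          (if m = 0 then
            (if k = 0 then ∏ v ∈ s, ∫ t in (-(1 / 2) : ℝ)..(1 / 2), φ v t else 0) else 0) := by
      intro φ k hφ hk m
      split_ifs with hm hk0
      · subst hm hk0
        simpa using ih hcl' φ 0 hφ (by simp)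
      · subst hm
        simpa [hk0] using ih hcl' φ k hφ fun v hv => hk v (Finset.mem_insert_of_mem hv)
      · -- The frequency of the coordinate `a` of the rotation becomes `-m ≠ 0`.
        have hk' : Function.update k a (-m) ≠ 0 := fun h0 => hm <| by
          simpa using congrFun h0 a
        have h0 := ih hcl'
          (fun w t => φ w t * Complex.exp (-(2 * Real.pi * Complex.I * m * (A a w * t))))
          (Function.update k a (-m)) (fun w => by have := hφ w; fun_prop) (fun v hv => by
            rw [Function.update_of_ne (by rintro rfl; exact ha hv)]
            exact hk v (Finset.mem_insert_of_mem hv))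
        rw [if_neg hk'] at h0
        refine (h0.const_mul
          (Complex.exp (-(2 * Real.pi * Complex.I * m * (β a + 1 / 2))))).congr (fun N => ?_)
          (mul_zero _)
        have hsum : ∑ w, A a w * e w N = ∑ w ∈ s, A a w * e w N := by
          refine (Finset.sum_subset (Finset.subset_univ s) fun w _ hw => ?_).symm
          rw [not_not.1 fun h => hw (has w h), zero_mul]
        have hlin : ∑ v, (Function.update k a (-m) v : ℝ) * α v =
            ∑ v, (k v : ℝ) * α v - m * α a := by
          have : ∀ v, (Function.update k a (-m) v : ℝ) * α v =
              k v * α v + if v = a then -(m * α a) else 0 := by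
            intro v
            by_cases hv : v = a
            · subst hv
              simp [hk v (Finset.mem_insert_self _ _)]
            · simp [hv]
          simp only [this, Finset.sum_add_distrib, Finset.sum_ite_eq', Finset.mem_univ, if_true]
          ring
        rw [he a N, fourier_roundingError, hsum, Finset.prod_mul_distrib, ← Complex.exp_sum,
          linearChar, linearChar, hlin, mul_assoc (∏ v ∈ s, φ v (e v N)),
          mul_assoc (∏ v ∈ s, φ v (e v N)), mul_left_comm, ← Complex.exp_add, ← Complex.exp_add,
          ← Complex.exp_add]
        congr 2
        push_cast
        rw [Finset.sum_neg_distrib, ← Finset.mul_sum]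
        ring
    have hbound : ∃ B, ∀ N, ‖(∏ v ∈ s, φ v (e v N)) * linearChar α k N‖ ≤ B := by
      choose C hC using fun v => isCompact_Icc.exists_bound_of_continuousOn
        (s := Icc (-(1 / 2) : ℝ) (1 / 2)) (hφ v).continuousOn
      refine ⟨∏ v ∈ s, C v, fun N => ?_⟩
      rw [norm_mul, norm_linearChar, mul_one, norm_prod]
      exact Finset.prod_le_prod (fun _ _ => norm_nonneg _) fun v _ =>
        hC v _ (Ico_subset_Icc_self (hmem v N))
    obtain ⟨B, hB⟩ := hbound
    refine (hasMean_mul_comp hB (hmem a) (fun m => ?_) (key φ k hφ hk) (hφ a)).congr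
      (fun N => ?_) ?_
    · have hone : ∫ _ in (-(1 / 2) : ℝ)..(1 / 2), (1 : ℂ) = 1 := by norm_num
      simpa only [linearChar, hone, Finset.prod_const_one, Pi.zero_apply, Int.cast_zero, zero_mul,
        Finset.sum_const_zero, Complex.ofReal_zero, mul_zero, Complex.exp_zero, one_mul, if_true]
        using key (fun _ _ => 1) 0 (fun _ => continuous_const) (by simp) m
    · rw [Finset.prod_insert ha]
      ring
    · rw [Finset.prod_insert ha]
      split_ifs <;> ring

/-- The errors of a triangular system are uncorrelated, and of mean square `1/12`. -/
theorem hasMean_mul_of_triangular [DecidableEq ι] {α β : ι → ℝ} (hα : IsQFree α) (rank : ι → ℕ)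
    {A : ι → ι → ℝ} (hA : ∀ v w, A v w ≠ 0 → rank w < rank v) {e : ι → ℕ → ℝ}
    (he : ∀ v N, e v N = roundingError (α v * N + β v + ∑ w, A v w * e w N)) (v w : ι) :
    HasMean (fun N => (e v N : ℂ) * e w N) (if v = w then 1 / 12 else 0) := by
  have hid : ∫ t in (-(1 / 2) : ℝ)..(1 / 2), (t : ℂ) = 0 := by
    rw [intervalIntegral.integral_ofReal, integral_id]
    norm_num
  have hsq : ∫ t in (-(1 / 2) : ℝ)..(1 / 2), (t : ℂ) ^ 2 = 1 / 12 := by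
    simp only [← Complex.ofReal_pow]
    rw [intervalIntegral.integral_ofReal, integral_pow]
    norm_num
  have main := fun φ hφ => hasMean_prod_mul_linearChar hα rank hA he Finset.univ
    (fun _ _ _ _ => Finset.mem_univ _) φ 0 hφ (fun _ _ => rfl)
  simp only [if_true] at main
  split_ifs with hvw
  · subst hvw
    refine (main (fun i t => if i = v then (t : ℂ) ^ 2 else 1)
      (fun i => by split_ifs <;> fun_prop)).congr (fun N => ?_) ?_
    · simp [linearChar, Finset.prod_ite_eq', sq]
    · rw [← Finset.mul_prod_erase _ _ (Finset.mem_univ v),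
        Finset.prod_eq_one fun i hi => ?_]
      · simpa only [if_true, mul_one] using hsq
      · simp only [if_neg (Finset.ne_of_mem_erase hi)]
        norm_num
  · refine (main (fun i t => (if i = v then (t : ℂ) else 1) * if i = w then (t : ℂ) else 1)
      (fun i => by split_ifs <;> fun_prop)).congr (fun N => ?_) ?_
    · rw [Finset.prod_mul_distrib, Finset.prod_ite_eq', Finset.prod_ite_eq']
      simp [linearChar]
    · refine Finset.prod_eq_zero (Finset.mem_univ v) ?_
      simpa [hvw] using hid

/-! ### Counting integers below a level along a path -/

/-- The largest integer whose image under `discretize c` is at most `M`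
(`discretize_le_iff`). -/
noncomputable def discretizeInv (c : ℝ) (M : ℤ) : ℤ := ⌈(M + 1 / 2) / c⌉ - 1

theorem discretize_le_iff {c : ℝ} (hc : 0 < c) (n M : ℤ) :
    discretize c n ≤ M ↔ n ≤ discretizeInv c M := by
  rw [discretize, round_eq, discretizeInv, Int.le_sub_one_iff, Int.lt_ceil, lt_div_iff₀ hc,
    ← Int.lt_add_one_iff, Int.floor_lt]
  push_cast
  constructor <;> intro h <;> linarith

theorem discretizeInv_zero {c : ℝ} (hc : 1 < c) : discretizeInv c 0 = 0 := by
  have : ⌈(((0 : ℤ) : ℝ) + 1 / 2) / c⌉ = 1 := by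
    rw [Int.ceil_eq_iff, div_le_iff₀ (by linarith)]
    constructor
    · simp only [Int.cast_one, sub_self]; positivity
    · push_cast; linarith
  rw [discretizeInv, this, sub_self]

theorem discretizeInv_neg_one {c : ℝ} (hc : 1 < c) : discretizeInv c (-1) = -1 := by
  have : ⌈(((-1 : ℤ) : ℝ) + 1 / 2) / c⌉ = 0 := by
    rw [Int.ceil_eq_iff, div_le_iff₀ (by linarith), lt_div_iff₀ (by linarith)]
    constructor <;> push_cast <;> linarith
  rw [discretizeInv, this, zero_sub]

variable {d : ℕ} {lam : List (Fin d) → ℝ}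

/-- The largest integer that the first `m` discretized maps above `v` send to an integer `≤ M`
(`pathDiscretization_le_iff`). -/
noncomputable def pathInv (lam : List (Fin d) → ℝ) : ℕ → List (Fin d) → ℤ → ℤ
  | 0, _, M => M
  | m + 1, v, M => discretizeInv (lam v) (pathInv lam m (parent v) M)

theorem pathDiscretization_succ_eq (v : List (Fin d)) (m : ℕ) (x : ℤ) :
    pathDiscretization lam v (m + 1) x =
      pathDiscretization lam (parent v) m (discretize (lam v) x) := by
  induction m with
  | zero => rfl
  | succ m ih =>
    rw [pathDiscretization, ih, pathDiscretization, ← Function.iterate_succ_apply]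

theorem pathDiscretization_le_iff {m : ℕ} {v : List (Fin d)}
    (h : ∀ j < m, 1 < lam (parent^[j] v)) (n M : ℤ) :
    pathDiscretization lam v m n ≤ M ↔ n ≤ pathInv lam m v M := by
  induction m generalizing v n with
  | zero => rfl
  | succ m ih =>
    have h0 : 1 < lam v := h 0 (Nat.succ_pos m)
    rw [pathDiscretization_succ_eq, ih fun j hj => by
      rw [← Function.iterate_succ_apply]; exact h (j + 1) (by lia)]
    exact discretize_le_iff (by linarith) _ _

theorem pathInv_of_fixed {m : ℕ} {v : List (Fin d)} {M : ℤ}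
    (hM : ∀ c : ℝ, 1 < c → discretizeInv c M = M) (h : ∀ j < m, 1 < lam (parent^[j] v)) :
    pathInv lam m v M = M := by
  induction m generalizing v with
  | zero => rfl
  | succ m ih =>
    rw [pathInv, ih fun j hj => by
      rw [← Function.iterate_succ_apply]; exact h (j + 1) (by lia)]
    exact hM _ (h 0 (Nat.succ_pos m))

theorem pathInv_zero {m : ℕ} {v : List (Fin d)} (h : ∀ j < m, 1 < lam (parent^[j] v)) :
    pathInv lam m v 0 = 0 :=
  pathInv_of_fixed (fun _ => discretizeInv_zero) h

theorem pathInv_neg_one {m : ℕ} {v : List (Fin d)} (h : ∀ j < m, 1 < lam (parent^[j] v)) :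
    pathInv lam m v (-1) = -1 :=
  pathInv_of_fixed (fun _ => discretizeInv_neg_one) h

theorem pathInv_nonneg {m : ℕ} {v : List (Fin d)} (h : ∀ j < m, 1 < lam (parent^[j] v)) {M : ℤ}
    (hM : 0 ≤ M) : 0 ≤ pathInv lam m v M := by
  have := (pathDiscretization_le_iff h 0 0).2 (pathInv_zero h).ge
  exact (pathDiscretization_le_iff h 0 M).1 (this.trans hM)

theorem pathDiscretization_pos_iff {m : ℕ} {v : List (Fin d)}
    (h : ∀ j < m, 1 < lam (parent^[j] v)) (n : ℤ) :
    0 < pathDiscretization lam v m n ↔ 0 < n := by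
  rw [← not_le, pathDiscretization_le_iff h, pathInv_zero h, not_le]

theorem pathDiscretization_nonneg_iff {m : ℕ} {v : List (Fin d)}
    (h : ∀ j < m, 1 < lam (parent^[j] v)) (n : ℤ) :
    0 ≤ pathDiscretization lam v m n ↔ 0 ≤ n := by
  have := pathDiscretization_le_iff h n (-1)
  rw [pathInv_neg_one h] at this
  lia

/-- The image of the counting measure on `ℤ` under the first `m` discretized maps above `v`. -/
noncomputable def pathMeasure (lam : List (Fin d) → ℝ) (v : List (Fin d)) (m : ℕ) : Measure ℝ :=
  Measure.sum fun n : ℤ => Measure.dirac ((pathDiscretization lam v m n : ℤ) : ℝ)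

theorem pathMeasure_eq_card {v : List (Fin d)} {m : ℕ} {S : Set ℝ} (hS : MeasurableSet S)
    (s : Finset ℤ) (h : ∀ n, ((pathDiscretization lam v m n : ℤ) : ℝ) ∈ S ↔ n ∈ s) :
    pathMeasure lam v m S = s.card := by
  rw [← Measure.count_apply_finset, pathMeasure, Measure.sum_apply _ hS, Measure.count,
    Measure.sum_apply _ s.measurableSet]
  congr 1
  funext n
  rw [Measure.dirac_apply' _ hS, Measure.dirac_apply' _ s.measurableSet]
  simp [indicator, h n]

variable {m : ℕ} {v : List (Fin d)}

theorem pathMeasure_Ioc (h : ∀ j < m, 1 < lam (parent^[j] v)) (y : ℝ) :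
    pathMeasure lam v m (Ioc 0 y) = (Finset.Ioc 0 (pathInv lam m v ⌊y⌋)).card :=
  pathMeasure_eq_card measurableSet_Ioc _ fun n => by
    rw [Finset.mem_Ioc, mem_Ioc, Int.cast_pos, pathDiscretization_pos_iff h, ← Int.le_floor,
      pathDiscretization_le_iff h]

theorem pathMeasure_Icc (h : ∀ j < m, 1 < lam (parent^[j] v)) (y : ℝ) :
    pathMeasure lam v m (Icc 0 y) = (Finset.Icc 0 (pathInv lam m v ⌊y⌋)).card :=
  pathMeasure_eq_card measurableSet_Icc _ fun n => by
    rw [Finset.mem_Icc, mem_Icc, Int.cast_nonneg_iff, pathDiscretization_nonneg_iff h,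
      ← Int.le_floor, pathDiscretization_le_iff h]

theorem pathMeasure_singleton_zero (h : ∀ j < m, 1 < lam (parent^[j] v)) :
    pathMeasure lam v m {0} = ((Finset.Icc 0 0 : Finset ℤ)).card :=
  pathMeasure_eq_card (measurableSet_singleton 0) _ fun n => by
    rw [Finset.mem_Icc, mem_singleton_iff, Int.cast_eq_zero, ← pathDiscretization_nonneg_iff h,
      ← pathInv_zero h, ← pathDiscretization_le_iff h, pathInv_zero h]
    lia

theorem pathMeasure_real_Ioc (h : ∀ j < m, 1 < lam (parent^[j] v)) {y : ℝ} (hy : 0 ≤ y) :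
    (pathMeasure lam v m).real (Ioc 0 y) = pathInv lam m v ⌊y⌋ := by
  rw [Measure.real, pathMeasure_Ioc h, Int.card_Ioc, sub_zero, ENNReal.toReal_natCast,
    ← Int.cast_natCast, Int.toNat_of_nonneg (pathInv_nonneg h (Int.floor_nonneg.2 hy))]

theorem pathMeasure_real_singleton_zero (h : ∀ j < m, 1 < lam (parent^[j] v)) :
    (pathMeasure lam v m).real {0} = 1 := by
  rw [Measure.real, pathMeasure_singleton_zero h]
  simp

/-! ### The rounding errors of the tree -/

theorem length_iterate_parent (i : List (Fin d)) (m : ℕ) :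
    (parent^[m] i).length = i.length - m := by
  induction m with
  | zero => rfl
  | succ m ih =>
    rw [Function.iterate_succ_apply', parent, List.length_dropLast, ih]
    lia

theorem iterate_parent_mem_treeNodes {k : ℕ} {i : List (Fin d)} (hi : i.length ≤ k)
    (hm : m < i.length) : parent^[m] i ∈ treeNodes d k := by
  constructor <;> rw [length_iterate_parent] <;> lia

/-- The number of integers in `(0, M]` reached from `v`, plus one half: the shift makes
the recursion along the path, `centredCount_concat`, a homothety followed by a rounding error. -/
noncomputable def centredCount (lam : List (Fin d) → ℝ) (v : List (Fin d)) (M : ℤ) : ℝ :=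
  pathInv lam v.length v M + 1 / 2

/-- The rounding error made at the vertex `v` in the computation of `centredCount lam v M` from
the value at the parent. -/
noncomputable def vertexError (lam : List (Fin d) → ℝ) (v : List (Fin d)) (M : ℤ) : ℝ :=
  roundingError (centredCount lam (parent v) M / lam v)

theorem parent_concat (v : List (Fin d)) (a : Fin d) : parent (v ++ [a]) = v :=
  List.dropLast_concat

theorem centredCount_concat (v : List (Fin d)) (a : Fin d) (M : ℤ) :
    centredCount lam (v ++ [a]) M =
      centredCount lam v M / lam (v ++ [a]) + vertexError lam (v ++ [a]) M := by
  rw [vertexError, roundingError, parent_concat, centredCount, List.length_append,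
    List.length_singleton, pathInv, parent_concat, discretizeInv, centredCount]
  push_cast
  ring

theorem pathMult_concat (v : List (Fin d)) (a : Fin d) :
    pathMult lam (v ++ [a]) = pathMult lam v * lam (v ++ [a]) := by
  rw [pathMult, List.length_append, List.length_singleton, Finset.prod_range_succ']
  simp only [Function.iterate_succ_apply, parent_concat, Function.iterate_zero, id]
  rfl

theorem pathMult_pos {k : ℕ} (hlam : ∀ i ∈ treeNodes d k, 1 < lam i) {v : List (Fin d)}
    (hv : v.length ≤ k) : 0 < pathMult lam v :=
  Finset.prod_pos fun _ hj => zero_lt_one.trans <|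
    hlam _ (iterate_parent_mem_treeNodes hv (Finset.mem_range.1 hj))

/-- Each error is carried from its vertex down to `v` by the maps of the vertices in between. -/
theorem centredCount_eq_sum {k : ℕ} (hlam : ∀ i ∈ treeNodes d k, 1 < lam i) {v : List (Fin d)}
    (hv : v.length ≤ k) (M : ℤ) :
    centredCount lam v M = (pathMult lam v)⁻¹ * (M + 1 / 2) +
      ∑ m ∈ Finset.range v.length,
        pathMult lam (parent^[m] v) / pathMult lam v * vertexError lam (parent^[m] v) M := by
  induction v using List.reverseRecOn with
  | nil => simp [centredCount, pathInv, pathMult]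
  | append_singleton v a ih =>
    have hv' : v.length ≤ k := by simp at hv; lia
    have h1 := pathMult_pos hlam hv'
    have h2 := pathMult_pos hlam hv
    have h3 : lam (v ++ [a]) ≠ 0 := by
      rw [pathMult_concat] at h2
      exact right_ne_zero_of_mul h2.ne'
    rw [centredCount_concat, ih hv', List.length_append, List.length_singleton,
      Finset.sum_range_succ']
    simp only [Function.iterate_succ_apply, parent_concat, Function.iterate_zero, id]
    rw [div_self h2.ne', one_mul, ← add_assoc, add_div, Finset.sum_div, pathMult_concat]
    congr 2
    · field_simp
    · refine Finset.sum_congr rfl fun m _ => ?_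
      field_simp

theorem finite_treeNodes (d k : ℕ) : (treeNodes d k).Finite :=
  (List.finite_length_le (Fin d) k).subset fun _ h => h.2

noncomputable instance (d k : ℕ) : Fintype (treeNodes d k) := (finite_treeNodes d k).fintype

/-- The errors of the tree form a triangular system driven by the rotation with angles
`(pathMult lam v)⁻¹`. -/
theorem exists_triangular_vertexError {k : ℕ} (hlam : ∀ i ∈ treeNodes d k, 1 < lam i)
    (v : treeNodes d k) :
    ∃ A : treeNodes d k → ℝ, (∀ w, A w ≠ 0 → w.1.length < v.1.length) ∧
      ∀ N : ℕ, vertexError lam v N = roundingError ((pathMult lam v)⁻¹ * N +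
        (pathMult lam v)⁻¹ / 2 + ∑ w, A w * vertexError lam w N) := by
  classical
  obtain ⟨v, hv1, hvk⟩ := v
  obtain ⟨p, a, rfl⟩ : ∃ p a, v = p ++ [a] := by
    rcases List.eq_nil_or_concat v with rfl | h
    · simp at hv1
    · simpa using h
  have hlen : (p ++ [a]).length = p.length + 1 := by simp
  have hp : p.length ≤ k := by lia
  refine ⟨fun w => ∑ m ∈ Finset.range p.length, if parent^[m] p = w then
    pathMult lam (parent^[m] p) / pathMult lam p / lam (p ++ [a]) else 0, fun w hw => ?_,
    fun N => ?_⟩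
  · obtain ⟨m, -, hm⟩ := Finset.exists_ne_zero_of_sum_ne_zero hw
    have : parent^[m] p = w := by
      by_contra h
      exact hm (if_neg h)
    rw [← this, length_iterate_parent, hlen]
    lia
  · rw [vertexError, parent_concat, centredCount_eq_sum hlam hp]
    congr 1
    have hcomm : ∑ w : treeNodes d k, (∑ m ∈ Finset.range p.length, if parent^[m] p = w.1 then
        pathMult lam (parent^[m] p) / pathMult lam p / lam (p ++ [a]) else 0) *
          vertexError lam w N = ∑ m ∈ Finset.range p.length,
        pathMult lam (parent^[m] p) / pathMult lam p * vertexError lam (parent^[m] p) N /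
          lam (p ++ [a]) := by
      simp only [Finset.sum_mul]
      rw [Finset.sum_comm]
      refine Finset.sum_congr rfl fun m hm => ?_
      rw [Finset.sum_eq_single ⟨parent^[m] p, iterate_parent_mem_treeNodes hp
        (Finset.mem_range.1 hm)⟩]
      · simp only [if_true]
        ring
      · intro w _ hw
        rw [if_neg fun h => hw (Subtype.ext h.symm), zero_mul]
      · simp
    rw [hcomm, pathMult_concat, add_div, Finset.sum_div, mul_inv]
    push_cast
    ring

/-- The errors made at the vertices of the tree are uncorrelated, of mean square `1/12`. -/
theorem hasMean_vertexError_mul {k : ℕ} (hlam : ∀ i ∈ treeNodes d k, 1 < lam i)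
    (hfree : IsQFree fun i : treeNodes d k => (pathMult lam (i : List (Fin d)))⁻¹)
    {v w : List (Fin d)} (hv : v ∈ treeNodes d k) (hw : w ∈ treeNodes d k) :
    HasMean (fun N => (vertexError lam v N : ℂ) * vertexError lam w N)
      (if v = w then 1 / 12 else 0) := by
  classical
  choose A hA he using exists_triangular_vertexError hlam
  have := hasMean_mul_of_triangular hfree (fun v => v.1.length) hA
    (e := fun v N => vertexError lam v N) he ⟨v, hv⟩ ⟨w, hw⟩
  simpa only [Subtype.mk.injEq] using this

/-! ### Averages over the half-line -/

theorem tendsto_average_integral {f : ℝ → ℝ} {C : ℝ} (hf : Measurable f) (hC : ∀ y, ‖f y‖ ≤ C)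
    {a : ℕ → ℝ} (ha : ∀ N : ℕ, ∫ y in (N : ℝ)..(N + 1), f y = a N) {l : ℝ}
    (hl : Tendsto (fun n : ℕ => (n : ℝ)⁻¹ * ∑ N ∈ Finset.range n, a N) atTop (𝓝 l)) :
    Tendsto (fun R : ℝ => 1 / R * ∫ y in (0 : ℝ)..R, f y) atTop (𝓝 l) := by
  have hint : ∀ x z : ℝ, IntervalIntegrable f volume x z := fun x z =>
    intervalIntegrable_const.mono_fun (g := f) (f := fun _ : ℝ => C) hf.aestronglyMeasurable
      (Eventually.of_forall fun y => (hC y).trans (le_abs_self C))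
  have hsum : ∀ n : ℕ, ∫ y in (0 : ℝ)..n, f y = ∑ N ∈ Finset.range n, a N := by
    intro n
    have := intervalIntegral.sum_integral_adjacent_intervals (f := f) (μ := volume)
      (a := fun N : ℕ => (N : ℝ)) (n := n) fun N _ => hint _ _
    rw [Nat.cast_zero] at this
    rw [← this]
    exact Finset.sum_congr rfl fun N _ => by rw [← ha N]; push_cast; rfl
  have hmain : Tendsto (fun R : ℝ => (⌊R⌋₊ : ℝ) / R *
      ((⌊R⌋₊ : ℝ)⁻¹ * ∑ N ∈ Finset.range ⌊R⌋₊, a N)) atTop (𝓝 (1 * l)) :=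
    tendsto_nat_floor_div_atTop.mul (hl.comp tendsto_nat_floor_atTop)
  have hrem : Tendsto (fun R : ℝ => 1 / R * ∫ y in (⌊R⌋₊ : ℝ)..R, f y) atTop (𝓝 0) := by
    have hlim : Tendsto (fun R : ℝ => C / R) atTop (𝓝 0) := tendsto_const_nhds.div_atTop tendsto_id
    refine squeeze_zero_norm' ?_ hlim
    filter_upwards [eventually_gt_atTop 0] with R hR
    have h1 := Nat.floor_le hR.le
    have h2 := Nat.lt_floor_add_one R
    have hC0 : 0 ≤ C := (norm_nonneg _).trans (hC 0)
    rw [norm_mul, norm_div, norm_one, Real.norm_of_nonneg hR.le, one_div, inv_mul_eq_div]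
    gcongr
    refine (intervalIntegral.norm_integral_le_of_norm_le_const fun y _ => hC y).trans ?_
    rw [abs_of_nonneg (by linarith)]
    nlinarith
  have := hmain.add hrem
  rw [one_mul, add_zero] at this
  refine this.congr' ?_
  filter_upwards [eventually_ge_atTop 1] with R hR
  have hfl : (⌊R⌋₊ : ℝ) ≠ 0 := by
    have := Nat.floor_pos.2 hR
    positivity
  rw [← intervalIntegral.integral_add_adjacent_intervals (hint 0 ⌊R⌋₊) (hint _ R), hsum]
  field_simp

theorem integral_sq_sub_mul (p τ : ℝ) :
    ∫ x in (0 : ℝ)..1, (τ * (1 / 2 - x) + p) ^ 2 = τ ^ 2 / 12 + p ^ 2 := by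
  have h : ∀ x ∈ uIcc (0 : ℝ) 1, HasDerivAt
      (fun x : ℝ => (τ / 2 + p) ^ 2 * x - (τ / 2 + p) * τ * x ^ 2 + τ ^ 2 * x ^ 3 / 3)
      ((τ * (1 / 2 - x) + p) ^ 2) x := by
    intro x _
    have h1 := (hasDerivAt_id x).const_mul ((τ / 2 + p) ^ 2)
    have h2 := (hasDerivAt_pow 2 x).const_mul ((τ / 2 + p) * τ)
    have h3 := ((hasDerivAt_pow 3 x).const_mul (τ ^ 2)).div_const 3
    refine ((h1.sub h2).add h3).congr_deriv ?_
    norm_num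
    ring
  rw [intervalIntegral.integral_eq_sub_of_hasDerivAt h
    ((by fun_prop : Continuous _).intervalIntegrable _ _)]
  ring

/-- The centred fractional part and the step function `E` are orthogonal on each unit interval, so
their mean squares add up. -/
theorem tendsto_average_integral_sq {E : ℕ → ℝ} {C : ℝ} (hE : ∀ N, |E N| ≤ C) (τ : ℝ) {σ : ℝ}
    (hσ : Tendsto (fun n : ℕ => (n : ℝ)⁻¹ * ∑ N ∈ Finset.range n, E N ^ 2) atTop (𝓝 σ)) :
    (∀ R : ℝ, IntervalIntegrable
      (fun y => (τ * (1 / 2 - Int.fract y) + E ⌊y⌋₊) ^ 2) volume 0 R) ∧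
    Tendsto (fun R : ℝ => 1 / R * ∫ y in (0 : ℝ)..R, (τ * (1 / 2 - Int.fract y) + E ⌊y⌋₊) ^ 2)
      atTop (𝓝 (τ ^ 2 / 12 + σ)) := by
  have hmeas : Measurable fun y : ℝ => (τ * (1 / 2 - Int.fract y) + E ⌊y⌋₊) ^ 2 := by
    have h1 : Measurable fun y : ℝ => E ⌊y⌋₊ := measurable_from_nat.comp Nat.measurable_floor
    have h2 : Measurable fun y : ℝ => Int.fract y := measurable_fract
    exact (((h2.const_sub _).const_mul τ).add h1).pow_const 2
  have hbd : ∀ y : ℝ, ‖(τ * (1 / 2 - Int.fract y) + E ⌊y⌋₊) ^ 2‖ ≤ (|τ| + C) ^ 2 := by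
    intro y
    rw [norm_pow, Real.norm_eq_abs]
    gcongr
    refine (abs_add_le _ _).trans (add_le_add ?_ (hE _))
    rw [abs_mul]
    refine mul_le_of_le_one_right (abs_nonneg _) (abs_le.2 ?_)
    constructor <;> linarith [Int.fract_nonneg y, Int.fract_lt_one y]
  refine ⟨fun R => intervalIntegrable_const.mono_fun (f := fun _ : ℝ => (|τ| + C) ^ 2)
    hmeas.aestronglyMeasurable (Eventually.of_forall fun y => (hbd y).trans (le_abs_self _)),
    tendsto_average_integral (a := fun N => τ ^ 2 / 12 + E N ^ 2) hmeas hbd (fun N => ?_) ?_⟩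
  · rw [← integral_sq_sub_mul (E N) τ]
    have hshift := intervalIntegral.integral_comp_sub_right (a := (N : ℝ)) (b := N + 1)
      (fun x => (τ * (1 / 2 - x) + E N) ^ 2) (N : ℝ)
    rw [sub_self, add_sub_cancel_left] at hshift
    rw [← hshift]
    refine intervalIntegral.integral_congr_Ioo_of_le (by linarith) fun y hy => ?_
    have hy0 : 0 ≤ y := (Nat.cast_nonneg N).trans hy.1.le
    have hfl : ⌊y⌋₊ = N := (Nat.floor_eq_iff hy0).2 ⟨hy.1.le, hy.2⟩
    have hfr : Int.fract y = y - N := by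
      rw [Int.fract, ← natCast_floor_eq_intCast_floor hy0, hfl]
    simp only [hfl, hfr]
  · refine (tendsto_const_nhds.add hσ).congr' ?_
    filter_upwards [eventually_gt_atTop 0] with n hn
    have : (n : ℝ) ≠ 0 := by positivity
    rw [Finset.sum_add_distrib, Finset.sum_const, Finset.card_range, nsmul_eq_mul]
    field_simp

/-! ### The cumulated difference -/

variable {k : ℕ}

theorem leaf_length (i : Leaf d k) : i.toList.length = k := i.toList_length

theorem one_lt_of_leaf (hlam : ∀ i ∈ treeNodes d k, 1 < lam i) (i : Leaf d k) :
    ∀ j < k, 1 < lam (parent^[j] i.toList) := fun j hj =>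
  hlam _ (iterate_parent_mem_treeNodes (leaf_length i).le (by rwa [leaf_length]))

theorem imageMeasure_apply (S : Set ℝ) :
    imageMeasure lam k S = ∑ i : Leaf d k, pathMeasure lam i.toList k S := by
  rw [imageMeasure, Measure.finsetSum_apply]
  rfl

theorem imageMeasure_Icc_lt_top (hlam : ∀ i ∈ treeNodes d k, 1 < lam i) (y : ℝ) :
    imageMeasure lam k (Icc 0 y) < ⊤ := by
  rw [imageMeasure_apply]
  refine ENNReal.sum_lt_top.2 fun i _ => ?_
  rw [pathMeasure_Icc (one_lt_of_leaf hlam i)]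
  exact ENNReal.natCast_lt_top _

theorem imageMeasure_real (hlam : ∀ i ∈ treeNodes d k, 1 < lam i) {S : Set ℝ} {y : ℝ}
    (hS : S ⊆ Icc 0 y) :
    (imageMeasure lam k).real S = ∑ i : Leaf d k, (pathMeasure lam i.toList k).real S := by
  rw [Measure.real, imageMeasure_apply, ENNReal.toReal_sum]
  · rfl
  · intro i _
    refine ((measure_mono hS).trans_lt ?_).ne
    rw [pathMeasure_Icc (one_lt_of_leaf hlam i)]
    exact ENNReal.natCast_lt_top _

/-- The contribution of all the rounding errors to the cumulated difference on `[N, N + 1)`. -/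
noncomputable def totalError (lam : List (Fin d) → ℝ) (k : ℕ) (N : ℕ) : ℝ :=
  ∑ i : Leaf d k, ∑ m ∈ Finset.range k,
    pathMult lam (parent^[m] i.toList) / pathMult lam i.toList *
      vertexError lam (parent^[m] i.toList) N

theorem inv_totMult : (totMult lam k)⁻¹ = ∑ i : Leaf d k, (pathMult lam i.toList)⁻¹ := by
  rw [totMult, inv_inv]

theorem cumDiff_eq (hlam : ∀ i ∈ treeNodes d k, 1 < lam i) {y : ℝ} (hy : 0 ≤ y) :
    cumDiff (imageMeasure lam k) (ENNReal.ofReal (totMult lam k)⁻¹ • volume) y =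
      (totMult lam k)⁻¹ * (1 / 2 - Int.fract y) + totalError lam k ⌊y⌋₊ := by
  have hτ : 0 ≤ (totMult lam k)⁻¹ := by
    rw [inv_totMult]
    exact Finset.sum_nonneg fun i _ => (inv_pos.2 (pathMult_pos hlam (leaf_length i).le)).le
  have hfl : (⌊y⌋ : ℝ) = y - Int.fract y := (Int.self_sub_fract y).symm
  have hcount : ∀ i : Leaf d k, (pathInv lam k i.toList ⌊y⌋ : ℝ) + 1 / 2 =
      (pathMult lam i.toList)⁻¹ * (y - Int.fract y + 1 / 2) + ∑ m ∈ Finset.range k,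
        pathMult lam (parent^[m] i.toList) / pathMult lam i.toList *
          vertexError lam (parent^[m] i.toList) ⌊y⌋₊ := by
    intro i
    have := centredCount_eq_sum hlam (leaf_length i).le ⌊y⌋
    rw [centredCount, leaf_length, hfl] at this
    rw [this, Int.natCast_floor_eq_floor hy]
  have h1 := imageMeasure_real hlam (S := Ioc 0 y) Ioc_subset_Icc_self
  have h2 := imageMeasure_real hlam (S := {0}) (y := 0) (by simp)
  simp only [fun i : Leaf d k => pathMeasure_real_Ioc (one_lt_of_leaf hlam i) hy] at h1
  simp only [fun i : Leaf d k => pathMeasure_real_singleton_zero (one_lt_of_leaf hlam i)] at h2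
  have h3 : (ENNReal.ofReal (totMult lam k)⁻¹ • (volume : Measure ℝ)).real (Ioc 0 y) =
      (totMult lam k)⁻¹ * y := by
    simp [measureReal_ennreal_smul_apply, hτ, hy]
  have h4 : (ENNReal.ofReal (totMult lam k)⁻¹ • (volume : Measure ℝ)).real {0} = 0 := by
    simp [Measure.real]
  rw [cumDiff, h1, h2, h3, h4, Finset.mul_sum, ← Finset.sum_add_distrib, mul_one,
    Finset.sum_congr rfl fun i _ => hcount i, Finset.sum_add_distrib, ← Finset.sum_mul,
    ← inv_totMult, totalError]
  ring

theorem abs_totalError_le : ∃ C, ∀ N, |totalError lam k N| ≤ C := by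
  refine ⟨∑ i : Leaf d k, ∑ m ∈ Finset.range k,
    |pathMult lam (parent^[m] i.toList) / pathMult lam i.toList|, fun N => ?_⟩
  refine (Finset.abs_sum_le_sum_abs _ _).trans (Finset.sum_le_sum fun i _ =>
    (Finset.abs_sum_le_sum_abs _ _).trans (Finset.sum_le_sum fun m _ => ?_))
  rw [abs_mul]
  refine mul_le_of_le_one_right (abs_nonneg _) (abs_le.2 ?_)
  have := roundingError_mem (centredCount lam (parent (parent^[m] i.toList)) N /
    lam (parent^[m] i.toList))
  constructor <;> rw [vertexError] <;> linarith [this.1, this.2]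

theorem mergeTime_le_iff (i j : Leaf d k) {m : ℕ} (hm : m ≤ k) :
    mergeTime i j ≤ m ↔ parent^[m] i.toList = parent^[m] j.toList := by
  have hk : parent^[k] i.toList = parent^[k] j.toList := by
    rw [List.eq_nil_of_length_eq_zero (l := parent^[k] i.toList),
      List.eq_nil_of_length_eq_zero (l := parent^[k] j.toList)] <;>
    simp [length_iterate_parent]
  constructor
  · intro h
    have hmem := Nat.sInf_mem (s := {m | m ≤ k ∧ parent^[m] i.toList = parent^[m] j.toList})
      ⟨k, le_rfl, hk⟩
    obtain ⟨t, rfl⟩ := Nat.exists_eq_add_of_le' h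
    rw [Function.iterate_add_apply, Function.iterate_add_apply]
    exact congrArg _ hmem.2
  · exact fun h => Nat.sInf_le ⟨hm, h⟩

/-- The mean square of the total error: two vertices above the leaves `i` and `j` contribute only if
they coincide, hence have the same height, which is at least the merging time. -/
theorem tendsto_average_totalError_sq (hlam : ∀ i ∈ treeNodes d k, 1 < lam i)
    (hfree : IsQFree fun i : treeNodes d k => (pathMult lam (i : List (Fin d)))⁻¹) :
    Tendsto (fun n : ℕ => (n : ℝ)⁻¹ * ∑ N ∈ Finset.range n, totalError lam k N ^ 2) atTop
      (𝓝 (1 / 12 * ∑ i : Leaf d k, ∑ j : Leaf d k, ∑ m ∈ Finset.Ico (mergeTime i j) k,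
        pathMult lam (parent^[m] i.toList) * pathMult lam (parent^[m] j.toList) /
          (pathMult lam i.toList * pathMult lam j.toList))) := by
  set c : Leaf d k → ℕ → ℝ := fun i m =>
    pathMult lam (parent^[m] i.toList) / pathMult lam i.toList with hc
  have hnode : ∀ (i : Leaf d k), ∀ m ∈ Finset.range k, parent^[m] i.toList ∈ treeNodes d k :=
    fun i m hm => iterate_parent_mem_treeNodes (leaf_length i).le
      (by rw [leaf_length]; exact Finset.mem_range.1 hm)
  have hmean : HasMean (fun N => ((totalError lam k N ^ 2 : ℝ) : ℂ))
      (∑ i : Leaf d k, ∑ j : Leaf d k, ∑ m ∈ Finset.range k, ∑ m' ∈ Finset.range k,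
        ((c i m * c j m' : ℝ) : ℂ) *
          if parent^[m] i.toList = parent^[m'] j.toList then 1 / 12 else 0) := by
    refine (HasMean.sum _ fun i _ => HasMean.sum _ fun j _ => HasMean.sum _ fun m hm =>
      HasMean.sum _ fun m' hm' => (hasMean_vertexError_mul hlam hfree (hnode i m hm)
        (hnode j m' hm')).const_mul ((c i m * c j m' : ℝ) : ℂ)).congr (fun N => ?_) rfl
    rw [totalError, sq, Finset.sum_mul_sum]
    push_cast
    refine Finset.sum_congr rfl fun i _ => Finset.sum_congr rfl fun j _ => ?_
    rw [Finset.sum_mul_sum]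
    refine Finset.sum_congr rfl fun m _ => Finset.sum_congr rfl fun m' _ => ?_
    simp only [hc]
    push_cast
    ring
  have hval : ∀ i j : Leaf d k, ∑ m ∈ Finset.range k, ∑ m' ∈ Finset.range k,
      ((c i m * c j m' : ℝ) : ℂ) *
        (if parent^[m] i.toList = parent^[m'] j.toList then 1 / 12 else 0) =
      ((1 / 12 * ∑ m ∈ Finset.Ico (mergeTime i j) k,
        pathMult lam (parent^[m] i.toList) * pathMult lam (parent^[m] j.toList) /
          (pathMult lam i.toList * pathMult lam j.toList) : ℝ) : ℂ) := by
    intro i j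
    have hIco : Finset.Ico (mergeTime i j) k =
        (Finset.range k).filter fun m => parent^[m] i.toList = parent^[m] j.toList := by
      ext m
      rw [Finset.mem_Ico, Finset.mem_filter, Finset.mem_range, and_comm]
      exact and_congr_right fun hm => mergeTime_le_iff i j hm.le
    rw [hIco, Finset.sum_filter, Finset.mul_sum, Complex.ofReal_sum]
    refine Finset.sum_congr rfl fun m hm => ?_
    rw [Finset.sum_eq_single m]
    · split_ifs
      · simp only [hc]
        push_cast
        ring
      · simp
    · intro m' hm' hne
      rw [if_neg fun h => hne ?_, mul_zero]
      have := congrArg List.length h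
      rw [length_iterate_parent, length_iterate_parent, leaf_length, leaf_length] at this
      rw [Finset.mem_range] at hm hm'
      lia
    · exact fun h => absurd hm h
  simp only [hval, ← Complex.ofReal_sum] at hmean
  have := (Complex.continuous_re.tendsto _).comp hmean
  simp only [Complex.ofReal_re, ← Finset.mul_sum] at this
  refine this.congr fun n => ?_
  simp only [Function.comp_apply, average, ← Complex.ofReal_sum, ← Complex.ofReal_natCast,
    ← Complex.ofReal_inv, ← Complex.ofReal_mul, Complex.ofReal_re]

end TreeDiscretization

theorem mainTheorem5 (d k : ℕ) (hd : 2 ≤ d) (lam : List (Fin d) → ℝ)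
    (hlam : ∀ i ∈ TreeDiscretization.treeNodes d k, 1 < lam i)
    (hfree : TreeDiscretization.IsQFree
      fun i : TreeDiscretization.treeNodes d k =>
        (TreeDiscretization.pathMult lam (i : List (Fin d)))⁻¹) :
    ∃ D : ℝ,
      TreeDiscretization.HasCramerDist
        (TreeDiscretization.imageMeasure lam k)
        (ENNReal.ofReal (TreeDiscretization.totMult lam k)⁻¹ • MeasureTheory.volume) D ∧
      D ^ 2 =
        1 / (12 * TreeDiscretization.totMult lam k ^ 2) +
          1 / 12 * ∑ i : TreeDiscretization.Leaf d k, ∑ j : TreeDiscretization.Leaf d k,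
            ∑ m ∈ Finset.Ico (TreeDiscretization.mergeTime i j) k,
              TreeDiscretization.pathMult lam (TreeDiscretization.parent^[m] i.toList) *
                TreeDiscretization.pathMult lam (TreeDiscretization.parent^[m] j.toList) /
              (TreeDiscretization.pathMult lam i.toList *
                TreeDiscretization.pathMult lam j.toList) := by
  obtain ⟨C, hC⟩ := TreeDiscretization.abs_totalError_le (lam := lam) (k := k)
  obtain ⟨hint, hlim⟩ := TreeDiscretization.tendsto_average_integral_sq hC
    (TreeDiscretization.totMult lam k)⁻¹
    (TreeDiscretization.tendsto_average_totalError_sq hlam hfree)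
  have hcongr : ∀ R : ℝ, 0 ≤ R → EqOn
      (fun y => ((TreeDiscretization.totMult lam k)⁻¹ * (1 / 2 - Int.fract y) +
        TreeDiscretization.totalError lam k ⌊y⌋₊) ^ 2)
      (fun y => TreeDiscretization.cumDiff (TreeDiscretization.imageMeasure lam k)
        (ENNReal.ofReal (TreeDiscretization.totMult lam k)⁻¹ • volume) y ^ 2) (uIcc 0 R) := by
    intro R hR y hy
    rw [uIcc_of_le hR] at hy
    simp only [TreeDiscretization.cumDiff_eq hlam hy.1]
  have hlim' := hlim.congr' (f₂ := fun R : ℝ => 1 / R * ∫ y in (0 : ℝ)..R,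
    TreeDiscretization.cumDiff (TreeDiscretization.imageMeasure lam k)
        (ENNReal.ofReal (TreeDiscretization.totMult lam k)⁻¹ • volume) y ^ 2) (by
    filter_upwards [eventually_ge_atTop 0] with R hR
    rw [intervalIntegral.integral_congr (hcongr R hR)])
  refine ⟨_, ⟨fun y => ⟨TreeDiscretization.imageMeasure_Icc_lt_top hlam y, ?_⟩, fun R hR =>
    (hint R).congr ((hcongr R hR.le).mono uIoc_subset_uIcc), hlim'.sqrt⟩, ?_⟩
  · rw [Measure.smul_apply, Real.volume_Icc, smul_eq_mul]
    exact ENNReal.mul_lt_top ENNReal.ofReal_lt_top ENNReal.ofReal_lt_top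
  · rw [Real.sq_sqrt]
    · congr 1
      rw [inv_pow, one_div, mul_inv, div_eq_mul_inv, mul_comm]
    · refine ge_of_tendsto hlim ?_
      filter_upwards [eventually_ge_atTop 0] with R hR
      exact mul_nonneg (by positivity)
        (intervalIntegral.integral_nonneg hR fun y _ => sq_nonneg _)
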